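/- Let $N,r\ge 1$ be integers, $H=1/N$, $h=H/r$, and $\Omega=(0,1)^2$. Let $\mathcal T_H$ be the uniform partition of $\overline\Omega$ into $N\times N$ closed squares with edges of length $H$, and let $\mathcal T_h$ be its uniform refinement into squares with edges of length $h$. Let $V_h\subset H^1_0(\Omega)$ be the $Q_1$ finite element space on $\mathcal T_h$, i.e. the continuous functions on $\overline\Omega$ that vanish on $\partial\Omega$ and are of the form $c_0+c_1x_1+c_2x_2+c_3x_1x_2$ on each square of $\mathcal T_h$. For $K\in\mathcal T_H$ let $V_h(K)$ be the space of restrictions to $K$ of the functions in $V_h$. A real number $\mu$ is an eigenvalue of the scaled discrete Laplace eigenproblem on $K$ if there is $\psi\in V_h(K)$ with $$\int_K\nabla\psi\cdot\nabla w\,dx=\mu\,H^{-2}\int_K\psi\,w\,dx\quad\text{for all } w\in V_h(K),\qquad H^{-2}\int_K\psi^2\,dx=1,$$ and $\mu_K$ denotes the smallest nonzero eigenvalue. Then there is an absolute constant $C$ (independent of $N$, $r$ and $K$) such that in each of the following cases $\mu_K$ exists, $\mu_K\le C$, and - $\mu_K>\pi^2$ if $K$ is disjoint from $\partial\Omega$;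 - $\mu_K>\pi^2/4$ if exactly one of the edges of $K$ lies on $\partial\Omega$; - $\mu_K>\pi^2/2$ if exactly two of the edges of $K$ lie on $\partial\Omega$. In particular $\mu_K\approx 1$, uniformly in $N$, $r$ and $K$, in these cases. -/

import Mathlib

open MeasureTheory

namespace ScaledQ1

noncomputable section

/-- The open unit square. -/
def unitSquare : Set (ℝ × ℝ) := Set.Ioo 0 1 ×ˢ Set.Ioo 0 1

/-- The closed square `[p/n, (p+1)/n] × [q/n, (q+1)/n]`, an element of the uniform partition of the
unit square into `n × n` squares with edges of length `1/n`. -/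
def cell (n : ℕ) (k : Fin n × Fin n) : Set (ℝ × ℝ) :=
  Set.Icc ((k.1 : ℝ) / n) (((k.1 : ℝ) + 1) / n) ×ˢ Set.Icc ((k.2 : ℝ) / n) (((k.2 : ℝ) + 1) / n)

/-- The four (closed) edges of a cell: left, right, bottom, top. -/
def cellEdge (n : ℕ) (k : Fin n × Fin n) : Fin 4 → Set (ℝ × ℝ) :=
  ![{(k.1 : ℝ) / n} ×ˢ Set.Icc ((k.2 : ℝ) / n) (((k.2 : ℝ) + 1) / n),
    {((k.1 : ℝ) + 1) / n} ×ˢ Set.Icc ((k.2 : ℝ) / n) (((k.2 : ℝ) + 1) / n),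
    Set.Icc ((k.1 : ℝ) / n) (((k.1 : ℝ) + 1) / n) ×ˢ {(k.2 : ℝ) / n},
    Set.Icc ((k.1 : ℝ) / n) (((k.1 : ℝ) + 1) / n) ×ˢ {((k.2 : ℝ) + 1) / n}]

/-- The number of edges of a cell that lie on the boundary of the unit square. -/
def numBoundaryEdges (n : ℕ) (k : Fin n × Fin n) : ℕ :=
  Set.ncard {e : Fin 4 | cellEdge n k e ⊆ frontier unitSquare}

/-- `v` is a `Q₁` polynomial on the set `S`: `v = c₀ + c₁ x₁ + c₂ x₂ + c₃ x₁ x₂` there. -/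
def IsQ1On (v : ℝ × ℝ → ℝ) (S : Set (ℝ × ℝ)) : Prop :=
  ∃ c₀ c₁ c₂ c₃ : ℝ, ∀ x ∈ S, v x = c₀ + c₁ * x.1 + c₂ * x.2 + c₃ * (x.1 * x.2)

/-- The `Q₁` finite element subspace of `H¹₀` of the unit square for the uniform `n × n` mesh:
continuous functions that are `Q₁` on every cell and vanish on the boundary. The functions are
extended by zero to the whole plane. -/
def femSpace (n : ℕ) : Submodule ℝ (ℝ × ℝ → ℝ) where
  carrier := {v | Continuous v ∧ (∀ x ∉ unitSquare, v x = 0) ∧ ∀ k, IsQ1On v (cell n k)}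
  zero_mem' := ⟨continuous_const, fun _ _ => rfl, fun _ => ⟨0, 0, 0, 0, fun _ _ => by simp⟩⟩
  add_mem' := by
    rintro u v ⟨hu, hu0, huq⟩ ⟨hv, hv0, hvq⟩
    refine ⟨hu.add hv, fun x hx => by simp [hu0 x hx, hv0 x hx], fun k => ?_⟩
    obtain ⟨a₀, a₁, a₂, a₃, ha⟩ := huq k
    obtain ⟨b₀, b₁, b₂, b₃, hb⟩ := hvq k
    refine ⟨a₀ + b₀, a₁ + b₁, a₂ + b₂, a₃ + b₃, fun x hx => ?_⟩
    rw [Pi.add_apply, ha x hx, hb x hx]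
    ring
  smul_mem' := by
    rintro c u ⟨hu, hu0, huq⟩
    refine ⟨hu.const_smul c, fun x hx => by simp [hu0 x hx], fun k => ?_⟩
    obtain ⟨a₀, a₁, a₂, a₃, ha⟩ := huq k
    refine ⟨c * a₀, c * a₁, c * a₂, c * a₃, fun x hx => ?_⟩
    rw [Pi.smul_apply, ha x hx, smul_eq_mul]
    ring

/-- The restriction of the fine finite element space (mesh size `h = 1/(N r)`) to the element
`cell N k` of the coarse mesh (mesh size `H = 1/N`). A function on the element is represented by
its extension by zero to the plane. -/
def localSpace (N r : ℕ) (k : Fin N × Fin N) : Submodule ℝ (ℝ × ℝ → ℝ) where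
  carrier := {v | ∃ u ∈ femSpace (N * r), v = (cell N k).indicator u}
  zero_mem' := ⟨0, Submodule.zero_mem _, (Set.indicator_zero' _).symm⟩
  add_mem' := by
    rintro _ _ ⟨u, hu, rfl⟩ ⟨v, hv, rfl⟩
    exact ⟨u + v, Submodule.add_mem _ hu hv, (Set.indicator_add' _ _ _).symm⟩
  smul_mem' := by
    rintro c _ ⟨u, hu, rfl⟩
    exact ⟨c • u, Submodule.smul_mem _ c hu, (Set.indicator_const_smul _ c u).symm⟩

/-- Partial derivative in the first variable. -/
def partial₁ (v : ℝ × ℝ → ℝ) (x : ℝ × ℝ) : ℝ := deriv (fun t => v (t, x.2)) x.1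

/-- Partial derivative in the second variable. -/
def partial₂ (v : ℝ × ℝ → ℝ) (x : ℝ × ℝ) : ℝ := deriv (fun t => v (x.1, t)) x.2

/-- The Dirichlet form on the coarse element, the integral of `∇v · ∇w`. Functions in the local
space are piecewise polynomial, so the gradient exists off a null set (the fine grid lines). -/
def stiffness (N : ℕ) (k : Fin N × Fin N) (v w : ℝ × ℝ → ℝ) : ℝ :=
  ∫ x in cell N k, (partial₁ v x * partial₁ w x + partial₂ v x * partial₂ w x)

/-- The scaled mass form on the coarse element: `H⁻²` times the integral of `v w`, where
`H = 1/N`. -/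
def scaledMass (N : ℕ) (k : Fin N × Fin N) (v w : ℝ × ℝ → ℝ) : ℝ :=
  ((1 / (N : ℝ)) ^ 2)⁻¹ * ∫ x in cell N k, v x * w x

/-- `μ` is an eigenvalue of the scaled discrete Laplace eigenproblem on the coarse element. -/
def IsEigenvalue (N r : ℕ) (k : Fin N × Fin N) (μ : ℝ) : Prop :=
  ∃ ψ ∈ localSpace N r k,
    (∀ w ∈ localSpace N r k, stiffness N k ψ w = μ * scaledMass N k ψ w) ∧
    scaledMass N k ψ ψ = 1

/-- `μ` is the first (smallest) nonzero eigenvalue. -/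
def IsFirstNonzeroEigenvalue (N r : ℕ) (k : Fin N × Fin N) (μ : ℝ) : Prop :=
  IsLeast {lam : ℝ | lam ≠ 0 ∧ IsEigenvalue N r k lam} μ

end

end ScaledQ1

namespace ScaledQ1

/-! The eigenproblem separates. In one variable, on a coarse interval cut into `r` pieces of length
`h`, the piecewise linear function with nodal values `cos (θ m + α)` satisfies the discrete
eigenvalue equation with factor `h⁻² * symbol θ`, up to terms at the two ends. Such a term vanishes
if the end lies on the boundary, where test functions are zero, or if `sin` of the phase there is
zero, the natural condition. The phases are thus `i π / r` on an interior interval and `(i + 1/2) π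
/ r` on an interval with one boundary end.

Products of such modes are eigenfunctions on the square (`IsMode.stiffness_mul`), with eigenvalue
`r² (symbol θ + symbol θ')` since `H = r h`. They are orthogonal, and there are as many of them as
free nodes, so they form a basis of the local space and no other eigenvalue exists
(`isEigenvalue_iff`).

As `symbol` increases on `[0, π]`, the first nonzero eigenvalue is `r² symbol (π / r)` on an
interior element, and `r² symbol (π / (2 r))` or twice that when one or two edges lie on the
boundary. The bounds `θ² < symbol θ ≤ 3 θ²` (`sq_lt_symbol`, `symbol_le`) remove `r` and finish the
proof. -/

/-- `u` is an affine function on the set `S`. -/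
def IsAffineOn (u : ℝ → ℝ) (S : Set ℝ) : Prop := ∃ a b : ℝ, ∀ x ∈ S, u x = a + b * x

/-! ### Bounds for the discrete symbol -/

/-- The symbol of the one-dimensional piecewise linear discretization of the Laplacian:
`h⁻² * symbol θ` is the discrete eigenvalue of the mode with phase increment `θ`. -/
noncomputable def symbol (θ : ℝ) : ℝ := 6 * (1 - Real.cos θ) / (2 + Real.cos θ)

lemma two_add_cos_pos (θ : ℝ) : 0 < 2 + Real.cos θ := by
  linarith [Real.neg_one_le_cos θ]

lemma symbol_zero : symbol 0 = 0 := by simp [symbol]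

lemma symbol_strictMonoOn : StrictMonoOn symbol (Set.Icc 0 Real.pi) := by
  intro s hs t ht hst
  have h := Real.strictAntiOn_cos hs ht hst
  rw [symbol, symbol, div_lt_div_iff₀ (two_add_cos_pos s) (two_add_cos_pos t)]
  nlinarith

lemma symbol_nonneg (θ : ℝ) : 0 ≤ symbol θ :=
  div_nonneg (by linarith [Real.cos_le_one θ]) (two_add_cos_pos θ).le

lemma symbol_le (θ : ℝ) : symbol θ ≤ 3 * θ ^ 2 := by
  rw [symbol, div_le_iff₀ (two_add_cos_pos θ)]
  have h1 := Real.one_sub_sq_div_two_le_cos (x := θ)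
  have h2 := Real.neg_one_le_cos θ
  nlinarith [mul_nonneg (sq_nonneg θ) (by linarith : 0 ≤ 1 + Real.cos θ)]

lemma self_sub_cube_div_six_le_sin {x : ℝ} (hx : 0 ≤ x) : x - x ^ 3 / 6 ≤ Real.sin x := by
  have hm : MonotoneOn (fun x : ℝ => Real.sin x - (x - x ^ 3 / 6)) (Set.Ici 0) := by
    refine monotoneOn_of_hasDerivWithinAt_nonneg (f' := fun x => Real.cos x - (1 - x ^ 2 / 2))
      (convex_Ici 0) (by fun_prop) (fun x _ => ?_) fun x _ => ?_
    · have := (Real.hasDerivAt_sin x).sub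
        ((hasDerivAt_id x).sub ((hasDerivAt_pow 3 x).div_const 6))
      exact (this.congr_deriv (by norm_num; ring)).hasDerivWithinAt
    · linarith [Real.one_sub_sq_div_two_le_cos (x := x)]
  have := hm (Set.mem_Ici.2 le_rfl) (Set.mem_Ici.2 hx) hx
  norm_num at this
  linarith

lemma cos_le_quartic {x : ℝ} (hx : 0 ≤ x) : Real.cos x ≤ 1 - x ^ 2 / 2 + x ^ 4 / 24 := by
  have hm : MonotoneOn (fun x : ℝ => 1 - x ^ 2 / 2 + x ^ 4 / 24 - Real.cos x) (Set.Ici 0) := by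
    refine monotoneOn_of_hasDerivWithinAt_nonneg (f' := fun x => Real.sin x - (x - x ^ 3 / 6))
      (convex_Ici 0) (by fun_prop) (fun x _ => ?_) fun x hx => ?_
    · have := ((((hasDerivAt_pow 2 x).div_const 2).const_sub 1).add
        ((hasDerivAt_pow 4 x).div_const 24)).sub (Real.hasDerivAt_cos x)
      exact (this.congr_deriv (by norm_num; ring)).hasDerivWithinAt
    · rw [interior_Ici] at hx
      linarith [self_sub_cube_div_six_le_sin (le_of_lt hx)]
  have := hm (Set.mem_Ici.2 le_rfl) (Set.mem_Ici.2 hx) hx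
  norm_num at this
  linarith

/-- The discrete eigenvalues exceed the continuous ones. -/
lemma sq_lt_symbol {θ : ℝ} (h0 : 0 < θ) (hpi : θ ≤ Real.pi) : θ ^ 2 < symbol θ := by
  rw [symbol, lt_div_iff₀ (two_add_cos_pos θ)]
  suffices h : Real.cos θ * (6 + θ ^ 2) < 6 - 2 * θ ^ 2 by linarith
  -- With `t = θ²`, the quartic bound for the cosine gives `(1 - t/2 + t²/24) (6 + t) = 6 - 2 t - t²
  -- (6 - t) / 24`, which settles `t < 6`. Beyond that the cosine is expanded at `π`.
  rcases lt_or_ge (θ ^ 2) 6 with h6 | h6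
  · have h1 := mul_le_mul_of_nonneg_right (cos_le_quartic h0.le)
      (by positivity : 0 ≤ 6 + θ ^ 2)
    have h2 : 0 < θ ^ 4 * (6 - θ ^ 2) := mul_pos (by positivity) (by linarith)
    nlinarith
  · have hπ : Real.pi < 3.142 := by linarith [Real.pi_lt_d4]
    have h1 := Real.one_sub_sq_div_two_le_cos (x := Real.pi - θ)
    rw [Real.cos_pi_sub] at h1
    suffices h : 2 * θ ^ 2 - 6 < (1 - (Real.pi - θ) ^ 2 / 2) * (6 + θ ^ 2) by
      have := mul_le_mul_of_nonneg_right h1 (by positivity : 0 ≤ 6 + θ ^ 2)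
      linarith
    -- `2.44² < 6`. The range is cut at `2.8` because one bound on `(π - θ)²` is too weak for all of
    -- it; `0.702` and `0.342` are `3.142 - 2.44` and `3.142 - 2.8`.
    have hθ : 2.44 ≤ θ := by nlinarith
    rcases le_or_gt θ 2.8 with h3 | h3
    · have hd : (Real.pi - θ) ^ 2 ≤ 0.702 ^ 2 := by
        apply pow_le_pow_left₀ <;> linarith
      have hs : θ ^ 2 ≤ 2.8 ^ 2 := by apply pow_le_pow_left₀ <;> linarith
      nlinarith
    · have hd : (Real.pi - θ) ^ 2 ≤ 0.342 ^ 2 := by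
        apply pow_le_pow_left₀ <;> linarith
      have hs : θ ^ 2 ≤ 3.142 ^ 2 := by apply pow_le_pow_left₀ <;> linarith
      nlinarith

/-! ### One-dimensional elements and discrete integration by parts -/

lemma IsAffineOn.deriv_eq {u : ℝ → ℝ} {a b : ℝ} (hab : a < b) (hu : IsAffineOn u (Set.Icc a b))
    {x : ℝ} (hx : x ∈ Set.Ioo a b) : deriv u x = (u b - u a) / (b - a) := by
  obtain ⟨c, d, h⟩ := hu
  have : u =ᶠ[nhds x] fun x => c + d * x := by
    filter_upwards [Icc_mem_nhds hx.1 hx.2] with y hy using h y hy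
  rw [this.deriv_eq, h b ⟨hab.le, le_rfl⟩, h a ⟨le_rfl, hab.le⟩]
  have : b - a ≠ 0 := by linarith
  simp
  field_simp

/-- At a mesh point `deriv` may take its default value, so integrands are compared only on open mesh
intervals. -/
lemma intervalIntegral_congr_Ioo {f g : ℝ → ℝ} {a b : ℝ} (hab : a < b)
    (h : ∀ x ∈ Set.Ioo a b, f x = g x) : ∫ x in a..b, f x = ∫ x in a..b, g x := by
  rw [intervalIntegral.integral_of_le hab.le, intervalIntegral.integral_of_le hab.le,
    integral_Ioc_eq_integral_Ioo, integral_Ioc_eq_integral_Ioo]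
  exact setIntegral_congr_fun measurableSet_Ioo h

lemma intervalIntegrable_congr_Ioo {f g : ℝ → ℝ} {a b : ℝ} (hab : a < b)
    (h : ∀ x ∈ Set.Ioo a b, f x = g x) (hg : Continuous g) :
    IntervalIntegrable f volume a b := by
  rw [intervalIntegrable_iff_integrableOn_Ioo_of_le hab.le]
  refine IntegrableOn.congr_fun ?_ (fun x hx => (h x hx).symm) measurableSet_Ioo
  exact (hg.integrableOn_Icc).mono_set Set.Ioo_subset_Icc_self

lemma integral_deriv_mul_deriv_of_affine {u v : ℝ → ℝ} {a b : ℝ} (hab : a < b)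
    (hu : IsAffineOn u (Set.Icc a b)) (hv : IsAffineOn v (Set.Icc a b)) :
    IntervalIntegrable (fun x => deriv u x * deriv v x) volume a b ∧
    ∫ x in a..b, deriv u x * deriv v x = (u b - u a) * (v b - v a) / (b - a) := by
  have h : ∀ x ∈ Set.Ioo a b, deriv u x * deriv v x =
      (u b - u a) / (b - a) * ((v b - v a) / (b - a)) := fun x hx => by
    rw [hu.deriv_eq hab hx, hv.deriv_eq hab hx]
  refine ⟨intervalIntegrable_congr_Ioo hab h continuous_const, ?_⟩
  rw [intervalIntegral_congr_Ioo hab h, intervalIntegral.integral_const, smul_eq_mul]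
  have : b - a ≠ 0 := by linarith
  field_simp

lemma integral_mul_of_affine {u v : ℝ → ℝ} {a b : ℝ} (hab : a < b)
    (hu : IsAffineOn u (Set.Icc a b)) (hv : IsAffineOn v (Set.Icc a b)) :
    IntervalIntegrable (fun x => u x * v x) volume a b ∧
    ∫ x in a..b, u x * v x =
      (b - a) / 6 * (2 * (u a * v a) + u a * v b + u b * v a + 2 * (u b * v b)) := by
  obtain ⟨c, d, h⟩ := hu
  obtain ⟨c', d', h'⟩ := hv
  have hI : ∀ x ∈ Set.Ioo a b, u x * v x =
      c * c' + (c * d' + c' * d) * x + d * d' * x ^ 2 := fun x hx => by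
    rw [h x (Set.Ioo_subset_Icc_self hx), h' x (Set.Ioo_subset_Icc_self hx)]; ring
  refine ⟨intervalIntegrable_congr_Ioo hab hI (by fun_prop), ?_⟩
  rw [intervalIntegral_congr_Ioo hab hI, intervalIntegral.integral_add, intervalIntegral.integral_add,
    intervalIntegral.integral_const_mul, intervalIntegral.integral_const_mul,
    intervalIntegral.integral_const_mul, intervalIntegral.integral_const, integral_id,
    integral_pow,
    h b ⟨hab.le, le_rfl⟩, h a ⟨le_rfl, hab.le⟩, h' b ⟨hab.le, le_rfl⟩, h' a ⟨le_rfl, hab.le⟩]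
  · simp
    ring
  all_goals exact Continuous.intervalIntegrable (by fun_prop) _ _

/-- The sum telescopes: by the addition formulas, each summand is the increment of `-3 sin θ / (2 +
cos θ) * sin (θ m + α) * w m`. The weights 2, 1, 1, 2 over 6 are those of the element mass matrix.
-/
lemma discrete_green {θ α : ℝ} {f w : ℕ → ℝ} {r : ℕ} (hf : ∀ m ≤ r, f m = Real.cos (θ * m + α)) :
    ∑ m ∈ Finset.range r, ((f (m + 1) - f m) * (w (m + 1) - w m) - symbol θ / 6 *
      (2 * (f m * w m) + f m * w (m + 1) + f (m + 1) * w m + 2 * (f (m + 1) * w (m + 1)))) =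
    -3 * Real.sin θ / (2 + Real.cos θ) *
      (Real.sin (θ * r + α) * w r - Real.sin α * w 0) := by
  induction r with
  | zero => simp
  | succ r ih =>
    rw [Finset.sum_range_succ, ih fun m hm => hf m (by omega), hf r (by omega), hf (r + 1) le_rfl]
    have e : θ * ((r + 1 : ℕ) : ℝ) + α = θ * r + α + θ := by push_cast; ring
    rw [e, Real.cos_add _ θ, Real.sin_add _ θ, symbol]
    have h2 := (two_add_cos_pos θ).ne'
    have h3 := Real.sin_sq_add_cos_sq θ
    generalize Real.cos (θ * r + α) = c, Real.sin (θ * r + α) = s, Real.sin α = s₀ at *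
    generalize Real.cos θ = C, Real.sin θ = S at *
    field_simp
    linear_combination (3 * c * w (r + 1) ) * h3 

/-- The discrete one-dimensional modes satisfy the weak eigenvalue equation. -/
lemma weak_eigen_one_dim {θ α h : ℝ} (hh : 0 < h) {x : ℕ → ℝ} (hx : ∀ m, x (m + 1) - x m = h)
    {r : ℕ} {u w : ℝ → ℝ} (hu : ∀ m < r, IsAffineOn u (Set.Icc (x m) (x (m + 1))))
    (hw : ∀ m < r, IsAffineOn w (Set.Icc (x m) (x (m + 1))))
    (hux : ∀ m ≤ r, u (x m) = Real.cos (θ * m + α))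
    (h0 : Real.sin α * w (x 0) = 0) (h1 : Real.sin (θ * r + α) * w (x r) = 0) :
    ∫ t in (x 0)..(x r), deriv u t * deriv w t =
      symbol θ / h ^ 2 * ∫ t in (x 0)..(x r), u t * w t := by
  have hlt : ∀ m, x m < x (m + 1) := fun m => by linarith [hx m]
  have A m (hm : m < r) := integral_deriv_mul_deriv_of_affine (hlt m) (hu m hm) (hw m hm)
  have B m (hm : m < r) := integral_mul_of_affine (hlt m) (hu m hm) (hw m hm)
  rw [← intervalIntegral.sum_integral_adjacent_intervals fun m hm => (A m hm).1,
    ← intervalIntegral.sum_integral_adjacent_intervals fun m hm => (B m hm).1]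
  rw [Finset.sum_congr rfl fun m hm => (A m (Finset.mem_range.1 hm)).2,
    Finset.sum_congr rfl fun m hm => (B m (Finset.mem_range.1 hm)).2]
  have G := discrete_green (θ := θ) (α := α) (f := fun m => u (x m)) (w := fun m => w (x m)) hux
  rw [h0, h1] at G
  simp only [sub_zero, mul_zero] at G
  rw [Finset.sum_sub_distrib, sub_eq_zero, ← Finset.mul_sum] at G
  simp only [hx]
  rw [← Finset.sum_div, G, ← Finset.mul_sum]
  field_simp

/-! ### Interpolation, nodes and one-dimensional modes -/

/-- The piecewise linear interpolant on the uniform mesh of the unit interval. -/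
lemma exists_interpolant {n : ℕ} (hn : 0 < n) {A : ℕ → ℝ} (h0 : A 0 = 0) (h1 : A n = 0) :
    ∃ u : ℝ → ℝ, Continuous u ∧ (∀ x ∉ Set.Ioo (0 : ℝ) 1, u x = 0) ∧
      (∀ p < n, IsAffineOn u (Set.Icc ((p : ℝ) / n) (((p : ℝ) + 1) / n))) ∧
      ∀ p ≤ n, u ((p : ℝ) / n) = A p := by
  have hn' : (0 : ℝ) < n := by exact_mod_cast hn
  -- A combination of hat functions. The two end hats reach outside the unit interval, but their
  -- coefficients are zero.
  refine ⟨fun x => ∑ i ∈ Finset.range (n + 1), A i * max 0 (1 - |n * x - i|), ?_, ?_, ?_, ?_⟩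
  · fun_prop
  · intro x hx
    refine Finset.sum_eq_zero fun i hi => ?_
    have hi : i ≤ n := Nat.lt_succ_iff.1 (Finset.mem_range.1 hi)
    rcases Nat.eq_zero_or_pos i with rfl | hi0
    · simp [h0]
    rcases hi.eq_or_lt with rfl | hin
    · simp [h1]
    rw [max_eq_left, mul_zero]
    have hi0' : (1 : ℝ) ≤ i := by exact_mod_cast hi0
    have hin' : (i : ℝ) + 1 ≤ n := by exact_mod_cast hin
    rw [Set.mem_Ioo, not_and_or, not_lt, not_lt] at hx
    rcases hx with hx | hx
    · have : n * x ≤ 0 := mul_nonpos_of_nonneg_of_nonpos hn'.le hx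
      rw [abs_of_nonpos (by linarith)]; linarith
    · have : (n : ℝ) ≤ n * x := le_mul_of_one_le_right hn'.le hx
      rw [abs_of_nonneg (by linarith)]; linarith
  · intro p hp
    have key : ∀ i : ℕ, IsAffineOn (fun x => A i * max 0 (1 - |n * x - i|))
        (Set.Icc ((p : ℝ) / n) (((p : ℝ) + 1) / n)) := by
      intro i
      have hb : ∀ x ∈ Set.Icc ((p : ℝ) / n) (((p : ℝ) + 1) / n), (p : ℝ) ≤ n * x ∧ n * x ≤ p + 1 := by
        rintro x ⟨hx, hx'⟩
        rw [div_le_iff₀ hn'] at hx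
        rw [le_div_iff₀ hn'] at hx'
        exact ⟨by linarith, by linarith⟩
      -- Only the hats at `p` and `p + 1` are nonzero on the `p`-th mesh interval.
      rcases lt_trichotomy i p with h | rfl | h
      · have h' : (i : ℝ) + 1 ≤ p := by exact_mod_cast h
        refine ⟨0, 0, fun x hx => ?_⟩
        have := hb x hx
        dsimp only
        rw [abs_of_nonneg (by linarith), max_eq_left (by linarith)]; ring
      · refine ⟨A i * (1 + i), -A i * n, fun x hx => ?_⟩
        have := hb x hx
        dsimp only
        rw [abs_of_nonneg (by linarith), max_eq_right (by linarith)]; ring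
      · rcases (Nat.succ_le_of_lt h).eq_or_lt with rfl | h
        · refine ⟨A (p + 1) * (- p), A (p + 1) * n, fun x hx => ?_⟩
          have := hb x hx
          rw [Nat.succ_eq_add_one]; push_cast
          rw [abs_of_nonpos (by linarith), max_eq_right (by linarith)]; ring
        · have h' : (p : ℝ) + 1 + 1 ≤ i := by exact_mod_cast h
          refine ⟨0, 0, fun x hx => ?_⟩
          have := hb x hx
          dsimp only
          rw [abs_of_nonpos (by linarith), max_eq_left (by linarith)]; ring
    choose a b hab using key
    refine ⟨∑ i ∈ Finset.range (n + 1), a i, ∑ i ∈ Finset.range (n + 1), b i, fun x hx => ?_⟩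
    rw [Finset.sum_mul, ← Finset.sum_add_distrib]
    exact Finset.sum_congr rfl fun i _ => hab i x hx
  · intro p hp
    simp only [mul_div_cancel₀ _ hn'.ne']
    rw [Finset.sum_eq_single p]
    · simp
    · intro i _ hi
      rw [max_eq_left, mul_zero]
      have : (1 : ℝ) ≤ |(p : ℝ) - i| := by
        have : (1 : ℤ) ≤ |(p : ℤ) - i| := Int.one_le_abs (by omega)
        exact_mod_cast this
      linarith
    · intro h; exact absurd (Finset.mem_range.2 (by omega)) h

/-- The nodes of the fine mesh, numbered from the left end of the `k`-th coarse interval. -/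
noncomputable def node (N r k m : ℕ) : ℝ := ((k * r + m : ℕ) : ℝ) / ((N * r : ℕ) : ℝ)

section nodes

variable {N r k : ℕ}

lemma node_zero (hr : 1 ≤ r) : node N r k 0 = (k : ℝ) / N := by
  have : (r : ℝ) ≠ 0 := by positivity
  simp [node]
  field_simp

lemma node_last (hr : 1 ≤ r) : node N r k r = ((k : ℝ) + 1) / N := by
  have : (r : ℝ) ≠ 0 := by positivity
  rw [node]
  push_cast
  field_simp

lemma node_succ_sub (m : ℕ) : node N r k (m + 1) - node N r k m = 1 / ((N * r : ℕ) : ℝ) := by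
  rw [node, node, ← sub_div]
  push_cast
  ring

lemma node_lt_succ (hN : 1 ≤ N) (hr : 1 ≤ r) (m : ℕ) : node N r k m < node N r k (m + 1) := by
  have := node_succ_sub (N := N) (r := r) (k := k) m
  have h : 0 < 1 / ((N * r : ℕ) : ℝ) := by positivity
  linarith

lemma Icc_node (m : ℕ) : Set.Icc (node N r k m) (node N r k (m + 1)) =
    Set.Icc (((k * r + m : ℕ) : ℝ) / ((N * r : ℕ) : ℝ))
      ((((k * r + m : ℕ) : ℝ) + 1) / ((N * r : ℕ) : ℝ)) := by
  simp only [node]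
  push_cast
  ring_nf

lemma index_lt (hk : k < N) {m : ℕ} (hm : m < r) : k * r + m < N * r := by
  have : (k + 1) * r ≤ N * r := Nat.mul_le_mul_right r hk
  rw [add_mul, one_mul] at this
  omega

lemma exists_mem_Icc_node (hr : 1 ≤ r) {x : ℝ}
    (hx : x ∈ Set.Icc ((k : ℝ) / N) (((k : ℝ) + 1) / N)) :
    ∃ m < r, x ∈ Set.Icc (node N r k m) (node N r k (m + 1)) := by
  have h1 : ∀ s, 1 ≤ s → x ∈ Set.Icc (node N r k 0) (node N r k s) →
      ∃ m < s, x ∈ Set.Icc (node N r k m) (node N r k (m + 1)) := by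
    intro s hs
    induction s, hs using Nat.le_induction with
    | base => exact fun h => ⟨0, zero_lt_one, h⟩
    | succ s hs ih =>
      intro h
      rcases le_total x (node N r k s) with h' | h'
      · obtain ⟨m, hm, hm'⟩ := ih ⟨h.1, h'⟩
        exact ⟨m, hm.trans s.lt_succ_self, hm'⟩
      · exact ⟨s, s.lt_succ_self, h', h.2⟩
  rw [← node_zero hr, ← node_last hr] at hx
  exact h1 r hr hx

lemma node_mono (hN : 1 ≤ N) (hr : 1 ≤ r) : Monotone (node N r k) :=
  monotone_nat_of_le_succ fun m => (node_lt_succ hN hr m).le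

lemma node_mem (hN : 1 ≤ N) (hr : 1 ≤ r) {m : ℕ} (hm : m ≤ r) :
    node N r k m ∈ Set.Icc ((k : ℝ) / N) (((k : ℝ) + 1) / N) := by
  rw [← node_zero hr, ← node_last hr]
  exact ⟨node_mono hN hr m.zero_le, node_mono hN hr hm⟩

end nodes

/-- `F` is a piecewise linear function on the unit interval, vanishing outside of it, that is a
discrete trigonometric mode on the `k`-th coarse interval. -/
structure IsMode (N r k : ℕ) (θ α : ℝ) (F : ℝ → ℝ) : Prop where
  continuous : Continuous F
  eq_zero : ∀ x ∉ Set.Ioo (0 : ℝ) 1, F x = 0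
  affine : ∀ p < N * r, IsAffineOn F
    (Set.Icc ((p : ℝ) / ((N * r : ℕ) : ℝ)) (((p : ℝ) + 1) / ((N * r : ℕ) : ℝ)))
  apply_node : ∀ m ≤ r, F (node N r k m) = Real.cos (θ * m + α)
  left : k = 0 ∨ Real.sin α = 0
  right : k + 1 = N ∨ Real.sin (θ * r + α) = 0

section modes

variable {N r k : ℕ} {θ α θ' α' : ℝ} {F G w : ℝ → ℝ}

lemma IsMode.weak_eigen (hF : IsMode N r k θ α F) (hN : 1 ≤ N) (hr : 1 ≤ r) (hk : k < N)
    (hw0 : ∀ x ∉ Set.Ioo (0 : ℝ) 1, w x = 0)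
    (hw : ∀ m < r, IsAffineOn w (Set.Icc (node N r k m) (node N r k (m + 1)))) :
    ∫ t in Set.Icc ((k : ℝ) / N) (((k : ℝ) + 1) / N), deriv F t * deriv w t =
      symbol θ * ((N : ℝ) * r) ^ 2 *
        ∫ t in Set.Icc ((k : ℝ) / N) (((k : ℝ) + 1) / N), F t * w t := by
  have hh : 0 < 1 / ((N * r : ℕ) : ℝ) := by positivity
  have hle := node_mono (k := k) hN hr r.zero_le
  have h0 : Real.sin α * w (node N r k 0) = 0 := by
    rcases hF.left with h | h
    · rw [hw0 _ (by simp [node, h]), mul_zero]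
    · rw [h, zero_mul]
  have h1 : Real.sin (θ * r + α) * w (node N r k r) = 0 := by
    rcases hF.right with h | h
    · have : (N : ℝ) ≠ 0 := by positivity
      have h' : ((k : ℝ) + 1) / N = 1 := by rw [← h] at this ⊢; push_cast at *; field_simp
      rw [node_last hr, h', hw0 _ (by simp), mul_zero]
    · rw [h, zero_mul]
  have := weak_eigen_one_dim hh (node_succ_sub (N := N) (r := r) (k := k))
    (fun m hm => by rw [Icc_node]; exact hF.affine _ (index_lt hk hm)) hw hF.apply_node h0 h1
  rw [intervalIntegral.integral_of_le hle, intervalIntegral.integral_of_le hle,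
    ← integral_Icc_eq_integral_Ioc, ← integral_Icc_eq_integral_Ioc, node_zero hr,
    node_last hr] at this
  rw [this]
  push_cast
  field_simp

/-- Each mode is an admissible test function for the other, so the symmetric Dirichlet form equals
the mass integral times two different factors. -/
lemma IsMode.integral_mul_eq_zero (hF : IsMode N r k θ α F) (hG : IsMode N r k θ' α' G)
    (hN : 1 ≤ N) (hr : 1 ≤ r) (hk : k < N) (h : symbol θ ≠ symbol θ') :
    ∫ t in Set.Icc ((k : ℝ) / N) (((k : ℝ) + 1) / N), F t * G t = 0 := by
  have h1 := hF.weak_eigen hN hr hk hG.eq_zero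
    fun m hm => by rw [Icc_node]; exact hG.affine _ (index_lt hk hm)
  have h2 := hG.weak_eigen hN hr hk hF.eq_zero
    fun m hm => by rw [Icc_node]; exact hF.affine _ (index_lt hk hm)
  simp only [mul_comm (deriv G _), mul_comm (G _)] at h2
  rw [h1, ← sub_eq_zero, ← sub_mul, ← sub_mul] at h2
  have : ((N : ℝ) * r) ^ 2 ≠ 0 := by positivity
  simpa [sub_eq_zero, h, this] using h2

lemma IsMode.integral_mul_self_pos (hF : IsMode N r k θ α F) (hN : 1 ≤ N) (hr : 1 ≤ r)
    {m : ℕ} (hm : m ≤ r) (h : Real.cos (θ * m + α) ≠ 0) :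
    0 < ∫ t in Set.Icc ((k : ℝ) / N) (((k : ℝ) + 1) / N), F t * F t := by
  have hlt : (k : ℝ) / N < ((k : ℝ) + 1) / N := by gcongr; linarith
  rw [integral_Icc_eq_integral_Ioc, ← intervalIntegral.integral_of_le hlt.le]
  have := hF.continuous
  refine intervalIntegral.integral_pos hlt (by fun_prop) (fun x _ => mul_self_nonneg _)
    ⟨_, node_mem hN hr hm, ?_⟩
  rw [hF.apply_node m hm]
  exact mul_self_pos.2 h

end modes

/-- Existence of a discrete mode with prescribed data on the coarse interval. -/
lemma exists_isMode {N r k : ℕ} {θ α : ℝ} (hN : 1 ≤ N) (hr : 1 ≤ r) (hk : k < N)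
    (h0 : k = 0 ∧ Real.cos α = 0 ∨ k ≠ 0 ∧ Real.sin α = 0)
    (h1 : k + 1 = N ∧ Real.cos (θ * r + α) = 0 ∨ k + 1 ≠ N ∧ Real.sin (θ * r + α) = 0) :
    ∃ F, IsMode N r k θ α F := by
  have hn : 0 < N * r := Nat.mul_pos hN hr
  -- Values at nodes outside the coarse interval do not matter, so truncated subtraction is
  -- harmless. When the coarse interval reaches the boundary, the forced zero agrees with the cosine
  -- by `h0` or `h1`.
  set A : ℕ → ℝ := fun p => if p = 0 ∨ p = N * r then 0 else
    Real.cos (θ * ((p - k * r : ℕ) : ℝ) + α) with hA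
  obtain ⟨F, hc, hz, ha, hv⟩ := exists_interpolant hn (A := A) (by simp [hA]) (by simp [hA])
  refine ⟨F, hc, hz, ha, fun m hm => ?_, h0.imp And.left And.right, h1.imp And.left And.right⟩
  have hle : (k + 1) * r ≤ N * r := Nat.mul_le_mul_right r hk
  rw [add_mul, one_mul] at hle
  rw [node, hv _ (by omega), hA]
  dsimp only
  rw [Nat.add_sub_cancel_left]
  split_ifs with h
  · rcases h with h | h
    · have hm0 : m = 0 := by omega
      have hk0 : k = 0 := by
        rcases Nat.mul_eq_zero.1 (show k * r = 0 by omega) with h | h <;> omega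
      rcases h0 with h0 | h0
      · simp [hm0, h0.2]
      · exact absurd hk0 h0.1
    · have hmr : m = r := by omega
      have hkN : k + 1 = N := by
        apply Nat.eq_of_mul_eq_mul_right hr
        rw [add_mul]; omega
      rcases h1 with h1 | h1
      · rw [hmr, h1.2]
      · exact absurd hkN h1.1
  · rfl

/-! ### Bilinear functions and products of modes on a coarse element -/

lemma IsQ1On.affine_left {u : ℝ × ℝ → ℝ} {S T : Set ℝ} (h : IsQ1On u (S ×ˢ T)) {y : ℝ}
    (hy : y ∈ T) : IsAffineOn (fun x => u (x, y)) S := by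
  obtain ⟨a, b, c, d, h⟩ := h
  exact ⟨a + c * y, b + d * y, fun x hx => by dsimp only; rw [h (x, y) ⟨hx, hy⟩]; ring⟩

lemma IsQ1On.swap {u : ℝ × ℝ → ℝ} {S T : Set ℝ} (h : IsQ1On u (S ×ˢ T)) :
    IsQ1On (fun z => u z.swap) (T ×ˢ S) := by
  obtain ⟨a, b, c, d, h⟩ := h
  exact ⟨a, c, b, d, fun z hz => by
    dsimp only; rw [h z.swap ⟨hz.2, hz.1⟩, Prod.fst_swap, Prod.snd_swap]; ring⟩

lemma IsQ1On.eq_zero_of_corners {u : ℝ × ℝ → ℝ} {a a' b b' : ℝ} (ha : a < a') (hb : b < b')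
    (h : IsQ1On u (Set.Icc a a' ×ˢ Set.Icc b b')) (h1 : u (a, b) = 0) (h2 : u (a', b) = 0)
    (h3 : u (a, b') = 0) (h4 : u (a', b') = 0) :
    ∀ x ∈ Set.Icc a a' ×ˢ Set.Icc b b', u x = 0 := by
  obtain ⟨c₀, c₁, c₂, c₃, h⟩ := h
  have ia : a ∈ Set.Icc a a' := ⟨le_rfl, ha.le⟩
  have ia' : a' ∈ Set.Icc a a' := ⟨ha.le, le_rfl⟩
  have ib : b ∈ Set.Icc b b' := ⟨le_rfl, hb.le⟩
  have ib' : b' ∈ Set.Icc b b' := ⟨hb.le, le_rfl⟩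
  rw [h _ ⟨ia, ib⟩] at h1
  rw [h _ ⟨ia', ib⟩] at h2
  rw [h _ ⟨ia, ib'⟩] at h3
  rw [h _ ⟨ia', ib'⟩] at h4
  have da : a' - a ≠ 0 := by linarith
  have db : b' - b ≠ 0 := by linarith
  -- The mixed second difference of the corner values isolates `c₃`.
  have e3 : c₃ = 0 := by
    have : (a' - a) * ((b' - b) * c₃) = 0 := by linear_combination h4 - h3 - h2 + h1
    simpa [da, db] using this
  subst e3
  have e1 : c₁ = 0 := by
    have : (a' - a) * c₁ = 0 := by linear_combination h2 - h1
    simpa [da] using this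
  have e2 : c₂ = 0 := by
    have : (b' - b) * c₂ = 0 := by linear_combination h3 - h1
    simpa [db] using this
  subst e1 e2
  have e0 : c₀ = 0 := by simpa using h1
  intro x hx
  rw [h x hx, e0]
  ring

lemma mem_unitSquare_swap {x : ℝ × ℝ} : x.swap ∈ unitSquare ↔ x ∈ unitSquare := by
  simp [unitSquare, and_comm]

lemma swap_mem_femSpace {n : ℕ} {u : ℝ × ℝ → ℝ} (hu : u ∈ femSpace n) :
    (fun z : ℝ × ℝ => u z.swap) ∈ femSpace n := by
  obtain ⟨h1, h2, h3⟩ := hu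
  refine ⟨h1.comp continuous_swap, fun x hx => h2 _ (by rwa [mem_unitSquare_swap]), fun k => ?_⟩
  exact (h3 k.swap).swap

section femSpace

variable {N r : ℕ} {k : Fin N × Fin N} {u : ℝ × ℝ → ℝ}

lemma isQ1On_of_mem_femSpace (hu : u ∈ femSpace (N * r)) {i j m l : ℕ} (hi : i < N) (hj : j < N)
    (hm : m < r) (hl : l < r) :
    IsQ1On u (Set.Icc (node N r i m) (node N r i (m + 1)) ×ˢ
      Set.Icc (node N r j l) (node N r j (l + 1))) := by
  rw [Icc_node, Icc_node]
  exact hu.2.2 (⟨_, index_lt hi hm⟩, ⟨_, index_lt hj hl⟩)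

lemma affine_of_mem_femSpace (hu : u ∈ femSpace (N * r)) (hr : 1 ≤ r)
    {i j m : ℕ} (hi : i < N) (hj : j < N) (hm : m < r) {y : ℝ}
    (hy : y ∈ Set.Icc ((j : ℝ) / N) (((j : ℝ) + 1) / N)) :
    IsAffineOn (fun x => u (x, y)) (Set.Icc (node N r i m) (node N r i (m + 1))) := by
  obtain ⟨l, hl, hy⟩ := exists_mem_Icc_node hr hy
  exact (isQ1On_of_mem_femSpace hu hi hj hm hl).affine_left hy

/-- A finite element function is determined on a coarse element by its nodal values there. -/
lemma eq_zero_of_node_eq_zero (hu : u ∈ femSpace (N * r)) (hN : 1 ≤ N) (hr : 1 ≤ r)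
    (h : ∀ m ≤ r, ∀ l ≤ r, u (node N r k.1 m, node N r k.2 l) = 0) :
    ∀ x ∈ cell N k, u x = 0 := by
  intro x hx
  obtain ⟨m, hm, hx1⟩ := exists_mem_Icc_node hr hx.1
  obtain ⟨l, hl, hx2⟩ := exists_mem_Icc_node hr hx.2
  exact (isQ1On_of_mem_femSpace hu k.1.2 k.2.2 hm hl).eq_zero_of_corners (node_lt_succ hN hr m)
    (node_lt_succ hN hr l) (h _ hm.le _ hl.le) (h _ hm _ hl.le) (h _ hm.le _ hl) (h _ hm _ hl)
    x ⟨hx1, hx2⟩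

lemma IsMode.mul_mem_femSpace {i j : ℕ} {θ α θ' α' : ℝ} {F G : ℝ → ℝ}
    (hF : IsMode N r i θ α F) (hG : IsMode N r j θ' α' G) :
    (fun z : ℝ × ℝ => F z.1 * G z.2) ∈ femSpace (N * r) := by
  refine ⟨(hF.continuous.comp continuous_fst).mul (hG.continuous.comp continuous_snd),
    fun x hx => ?_, fun k => ?_⟩
  · rw [unitSquare, Set.mem_prod, not_and_or] at hx
    rcases hx with hx | hx
    · simp [hF.eq_zero _ hx]
    · simp [hG.eq_zero _ hx]
  · obtain ⟨a, b, h⟩ := hF.affine _ k.1.2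
    obtain ⟨a', b', h'⟩ := hG.affine _ k.2.2
    refine ⟨a * a', b * a', a * b', b * b', fun x hx => ?_⟩
    dsimp only
    rw [h _ hx.1, h' _ hx.2]
    ring

lemma openCell_ae_eq (a a' b b' : ℝ) :
    (Set.Ioo a a' ×ˢ Set.Ioo b b' : Set (ℝ × ℝ)) =ᵐ[volume] Set.Icc a a' ×ˢ Set.Icc b b' :=
  Measure.set_prod_ae_eq Ioo_ae_eq_Icc Ioo_ae_eq_Icc

lemma IsQ1On.partial₁_eq {a a' b b' : ℝ} {c₀ c₁ c₂ c₃ : ℝ}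
    (h : ∀ x ∈ Set.Icc a a' ×ˢ Set.Icc b b', u x = c₀ + c₁ * x.1 + c₂ * x.2 + c₃ * (x.1 * x.2))
    {z : ℝ × ℝ} (hz : z ∈ Set.Ioo a a' ×ˢ Set.Ioo b b') : partial₁ u z = c₁ + c₃ * z.2 := by
  have : (fun t => u (t, z.2)) =ᶠ[nhds z.1] fun t => (c₀ + c₂ * z.2) + (c₁ + c₃ * z.2) * t := by
    filter_upwards [Icc_mem_nhds hz.1.1 hz.1.2] with t ht
    rw [h (t, z.2) ⟨ht, Set.Ioo_subset_Icc_self hz.2⟩]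
    ring
  rw [partial₁, this.deriv_eq]
  simp

/-- Needed for Fubini: inside each fine square the integrand agrees with a continuous function, and
the edges are null. -/
lemma IsMode.integrableOn_deriv_mul (hu : u ∈ femSpace (N * r)) (hN : 1 ≤ N) (hr : 1 ≤ r)
    {i j : ℕ} (hi : i < N) (hj : j < N) {θ α : ℝ} {F G : ℝ → ℝ} (hF : IsMode N r i θ α F)
    (hG : Continuous G) :
    IntegrableOn (fun z => deriv F z.1 * G z.2 * partial₁ u z)
      (Set.Icc ((i : ℝ) / N) (((i : ℝ) + 1) / N) ×ˢ
        Set.Icc ((j : ℝ) / N) (((j : ℝ) + 1) / N)) := by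
  have hsub : Set.Icc ((i : ℝ) / N) (((i : ℝ) + 1) / N) ×ˢ
        Set.Icc ((j : ℝ) / N) (((j : ℝ) + 1) / N) ⊆ ⋃ p : Fin r × Fin r,
        Set.Icc (node N r i p.1) (node N r i (p.1 + 1)) ×ˢ
          Set.Icc (node N r j p.2) (node N r j (p.2 + 1)) := by
    intro x hx
    obtain ⟨m, hm, hx1⟩ := exists_mem_Icc_node hr hx.1
    obtain ⟨l, hl, hx2⟩ := exists_mem_Icc_node hr hx.2
    exact Set.mem_iUnion.2 ⟨(⟨m, hm⟩, ⟨l, hl⟩), hx1, hx2⟩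
  refine IntegrableOn.mono_set (integrableOn_finite_iUnion.2 fun p => ?_) hsub
  obtain ⟨c₀, c₁, c₂, c₃, h⟩ := isQ1On_of_mem_femSpace hu hi hj p.1.2 p.2.2
  have hFa : IsAffineOn F (Set.Icc (node N r i p.1) (node N r i (p.1 + 1))) := by
    rw [Icc_node]; exact hF.affine _ (index_lt hi p.1.2)
  rw [← integrableOn_congr_set_ae (openCell_ae_eq _ _ _ _)]
  refine IntegrableOn.congr_fun (f := fun z => (F (node N r i (p.1 + 1)) - F (node N r i p.1)) /
    (node N r i (p.1 + 1) - node N r i p.1) * G z.2 * (c₁ + c₃ * z.2)) ?_ (fun z hz => ?_)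
    (measurableSet_Ioo.prod measurableSet_Ioo)
  · refine IntegrableOn.mono_set ?_ (Set.prod_mono Set.Ioo_subset_Icc_self Set.Ioo_subset_Icc_self)
    exact Continuous.continuousOn (by fun_prop) |>.integrableOn_compact (isCompact_Icc.prod isCompact_Icc)
  · dsimp only
    rw [hFa.deriv_eq (node_lt_succ hN hr _) hz.1, IsQ1On.partial₁_eq h hz]

lemma setIntegral_prod_right' {f : ℝ × ℝ → ℝ} {S T : Set ℝ} (hf : IntegrableOn f (S ×ˢ T)) :
    ∫ z in S ×ˢ T, f z = ∫ y in T, ∫ x in S, f (x, y) := by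
  rw [IntegrableOn, Measure.volume_eq_prod, ← Measure.prod_restrict] at hf
  rw [Measure.volume_eq_prod, ← Measure.prod_restrict, integral_prod_symm _ hf]

/-- For fixed `y` the slice of `u` is piecewise linear and vanishes outside the unit interval, so it
can be tested against the mode `F`; the result is weighted by `G y` and integrated in `y`. -/
lemma IsMode.integral_deriv_mul (hu : u ∈ femSpace (N * r)) (hN : 1 ≤ N) (hr : 1 ≤ r)
    {i j : ℕ} (hi : i < N) (hj : j < N) {θ α : ℝ} {F G : ℝ → ℝ} (hF : IsMode N r i θ α F)
    (hG : Continuous G) :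
    ∫ z in Set.Icc ((i : ℝ) / N) (((i : ℝ) + 1) / N) ×ˢ
        Set.Icc ((j : ℝ) / N) (((j : ℝ) + 1) / N), deriv F z.1 * G z.2 * partial₁ u z =
      symbol θ * ((N : ℝ) * r) ^ 2 * ∫ z in Set.Icc ((i : ℝ) / N) (((i : ℝ) + 1) / N) ×ˢ
        Set.Icc ((j : ℝ) / N) (((j : ℝ) + 1) / N), F z.1 * G z.2 * u z := by
  have hFc := hF.continuous
  have huc : Continuous u := hu.1
  rw [setIntegral_prod_right' (hF.integrableOn_deriv_mul hu hN hr hi hj hG),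
    setIntegral_prod_right' (Continuous.continuousOn (by fun_prop) |>.integrableOn_compact
      (isCompact_Icc.prod isCompact_Icc)), ← integral_const_mul]
  refine setIntegral_congr_fun measurableSet_Icc fun y hy => ?_
  have := hF.weak_eigen (w := fun x => u (x, y)) hN hr hi
    (fun x hx => hu.2.1 _ fun h => hx h.1)
    (fun m hm => affine_of_mem_femSpace hu hr hi hj hm hy)
  have e1 : ∀ x, deriv F x * G y * partial₁ u (x, y) =
      G y * (deriv F x * deriv (fun x => u (x, y)) x) := fun x => by rw [partial₁]; ring
  have e2 : ∀ x, F x * G y * u (x, y) = G y * (F x * u (x, y)) := fun x => by ring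
  simp only [e1, e2, integral_const_mul, this]
  ring

lemma cell_eq (N : ℕ) (k : Fin N × Fin N) : cell N k =
    Set.Icc ((k.1 : ℝ) / N) (((k.1 : ℝ) + 1) / N) ×ˢ
      Set.Icc ((k.2 : ℝ) / N) (((k.2 : ℝ) + 1) / N) := rfl

lemma isCompact_cell (N : ℕ) (k : Fin N × Fin N) : IsCompact (cell N k) :=
  isCompact_Icc.prod isCompact_Icc

lemma measurableSet_cell (N : ℕ) (k : Fin N × Fin N) : MeasurableSet (cell N k) :=
  measurableSet_Icc.prod measurableSet_Icc

lemma partial_indicator {v : ℝ × ℝ → ℝ} {S : Set (ℝ × ℝ)} {z : ℝ × ℝ} (h : S ∈ nhds z) :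
    partial₁ (S.indicator v) z = partial₁ v z ∧ partial₂ (S.indicator v) z = partial₂ v z := by
  have hv : S.indicator v =ᶠ[nhds z] v := by
    filter_upwards [h] with x hx using Set.indicator_of_mem hx v
  constructor
  · refine Filter.EventuallyEq.deriv_eq ?_
    exact (show Continuous fun t : ℝ => (t, z.2) by fun_prop).continuousAt.eventually hv
  · refine Filter.EventuallyEq.deriv_eq ?_
    exact (show Continuous fun t : ℝ => (z.1, t) by fun_prop).continuousAt.eventually hv

/-- Within the element, extension by zero can alter the partial derivatives only on the boundary, a
null set. -/
lemma stiffness_indicator (v w : ℝ × ℝ → ℝ) :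
    stiffness N k ((cell N k).indicator v) ((cell N k).indicator w) = stiffness N k v w := by
  rw [stiffness, stiffness, cell_eq, ← setIntegral_congr_set (openCell_ae_eq _ _ _ _),
    ← setIntegral_congr_set (openCell_ae_eq _ _ _ _)]
  refine setIntegral_congr_fun (measurableSet_Ioo.prod measurableSet_Ioo) fun z hz => ?_
  have h := prod_mem_nhds (Icc_mem_nhds hz.1.1 hz.1.2) (Icc_mem_nhds hz.2.1 hz.2.2)
  rw [(partial_indicator h).1, (partial_indicator h).2, (partial_indicator h).1,
    (partial_indicator h).2]

lemma scaledMass_indicator (v w : ℝ × ℝ → ℝ) :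
    scaledMass N k ((cell N k).indicator v) ((cell N k).indicator w) = scaledMass N k v w := by
  rw [scaledMass, scaledMass]
  congr 1
  refine setIntegral_congr_fun (measurableSet_cell N k) fun z hz => ?_
  rw [Set.indicator_of_mem hz, Set.indicator_of_mem hz]

/-- Products of one-dimensional modes satisfy the weak eigenvalue equation. -/
lemma IsMode.stiffness_mul (hu : u ∈ femSpace (N * r)) (hN : 1 ≤ N) (hr : 1 ≤ r)
    {θ α θ' α' : ℝ} {F G : ℝ → ℝ} (hF : IsMode N r k.1 θ α F) (hG : IsMode N r k.2 θ' α' G) :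
    stiffness N k (fun z => F z.1 * G z.2) u =
      (r : ℝ) ^ 2 * (symbol θ + symbol θ') * scaledMass N k (fun z => F z.1 * G z.2) u := by
  -- The part with derivatives in the second variable is the first part for the reflected function.
  have hu' := swap_mem_femSpace hu
  have i1 := hF.integrableOn_deriv_mul hu hN hr k.1.2 k.2.2 hG.continuous
  have i2 := hG.integrableOn_deriv_mul hu' hN hr k.2.2 k.1.2 hF.continuous
  have e1 := hF.integral_deriv_mul hu hN hr k.1.2 k.2.2 hG.continuous
  have e2 := hG.integral_deriv_mul hu' hN hr k.2.2 k.1.2 hF.continuous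
  rw [Measure.volume_eq_prod, ← setIntegral_prod_swap,
    ← setIntegral_prod_swap _ _ (fun z : ℝ × ℝ => G z.1 * F z.2 * u z.swap)] at e2
  rw [Measure.volume_eq_prod] at i2
  have i2' := i2.swap
  have e3 : ∀ z : ℝ × ℝ, partial₁ (fun z : ℝ × ℝ => u z.swap) z.swap = partial₂ u z := fun z => rfl
  simp only [Prod.swap_swap, Prod.fst_swap, Prod.snd_swap, e3, Function.comp_def] at e2 i2'
  rw [← Measure.volume_eq_prod] at e2 i2'
  have e4 : ∀ z : ℝ × ℝ, partial₁ (fun z : ℝ × ℝ => F z.1 * G z.2) z = deriv F z.1 * G z.2 :=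
    fun z => deriv_mul_const_field (u := F) (G z.2)
  have e5 : ∀ z : ℝ × ℝ, partial₂ (fun z : ℝ × ℝ => F z.1 * G z.2) z = F z.1 * deriv G z.2 :=
    fun z => deriv_const_mul_field (v := G) (F z.1)
  simp only [mul_comm (deriv G _), mul_comm (G _)] at e2 i2'
  simp only [stiffness, e4, e5, scaledMass]
  rw [cell_eq, integral_add i1 i2', e1, e2]
  have : (N : ℝ) ≠ 0 := by positivity
  field_simp

end femSpace

/-! ### Admissible phases and free nodes -/

/-- The smallest phase increment: `0` on an interior coarse interval, `π / (2 r)` on a coarse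
interval that touches the boundary. The others follow in steps of `π / r`. -/
noncomputable def phase (N r k i : ℕ) : ℝ :=
  ((i : ℝ) + if k = 0 ∨ k + 1 = N then 1 / 2 else 0) * Real.pi / r

/-- The phase shift of the modes on the `k`-th coarse interval. -/
noncomputable def phaseShift (k : ℕ) : ℝ := if k = 0 then -(Real.pi / 2) else 0

/-- The dimension of the one-dimensional local space on the `k`-th coarse interval. -/
def localDim (N r k : ℕ) : ℕ := if k = 0 ∨ k + 1 = N then r else r + 1

/-- The nodes that are not on the boundary. -/
def freeIndex (k i : ℕ) : ℕ := if k = 0 then i + 1 else i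

section oneDim

variable {N r k : ℕ}

lemma phase_nonneg (i : ℕ) : 0 ≤ phase N r k i := by
  unfold phase; split_ifs <;> positivity

lemma phase_le_pi (hr : 1 ≤ r) {i : ℕ} (hi : i < localDim N r k) : phase N r k i ≤ Real.pi := by
  have hr' : (0 : ℝ) < r := by positivity
  rw [phase, div_le_iff₀ hr', mul_comm Real.pi]
  refine mul_le_mul_of_nonneg_right ?_ Real.pi_pos.le
  unfold localDim at hi
  split_ifs at hi ⊢
  · have : (i : ℝ) + 1 ≤ r := by exact_mod_cast hi
    linarith
  · have : (i : ℝ) ≤ r := by exact_mod_cast Nat.lt_succ_iff.1 hi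
    linarith

lemma phase_strictMono (hr : 1 ≤ r) : StrictMono (phase N r k) := by
  intro i j hij
  have hr' : (0 : ℝ) < r := by positivity
  have : (i : ℝ) < j := by exact_mod_cast hij
  unfold phase
  have := Real.pi_pos
  gcongr

lemma symbol_phase_lt (hr : 1 ≤ r) {i j : ℕ} (hij : i < j) (hj : j < localDim N r k) :
    symbol (phase N r k i) < symbol (phase N r k j) :=
  symbol_strictMonoOn ⟨phase_nonneg i, phase_le_pi hr (hij.trans hj)⟩
    ⟨phase_nonneg j, phase_le_pi hr hj⟩ (phase_strictMono hr hij)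

lemma symbol_phase_ne (hr : 1 ≤ r) {i j : ℕ} (hi : i < localDim N r k) (hj : j < localDim N r k)
    (hij : i ≠ j) : symbol (phase N r k i) ≠ symbol (phase N r k j) := by
  rcases lt_or_gt_of_ne hij with h | h
  · exact (symbol_phase_lt hr h hj).ne
  · exact (symbol_phase_lt hr h hi).ne'

/-- `2 ≤ N` ensures that at most one end of a coarse interval is on the boundary. With two such ends
the half-integer phases would be wrong. -/
lemma exists_mode (hN : 2 ≤ N) (hr : 1 ≤ r) (hk : k < N) (i : ℕ) :
    ∃ F, IsMode N r k (phase N r k i) (phaseShift k) F := by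
  have hr' : (r : ℝ) ≠ 0 := by positivity
  have e : phase N r k i * r =
      ((i : ℝ) + if k = 0 ∨ k + 1 = N then 1 / 2 else 0) * Real.pi := by
    rw [phase]; field_simp
  apply exists_isMode (by omega) hr hk
  · unfold phaseShift
    split_ifs with h <;> simp [h]
  · rw [e]
    unfold phaseShift
    by_cases h0 : k = 0
    · right
      have : (0 : ℕ) + 1 ≠ N := by omega
      subst h0
      refine ⟨this, ?_⟩
      simp only [true_or, if_true]
      rw [show ((i : ℝ) + 1 / 2) * Real.pi + -(Real.pi / 2) = i * Real.pi by ring,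
        Real.sin_nat_mul_pi]
    · by_cases h1 : k + 1 = N
      · left
        refine ⟨h1, ?_⟩
        simp only [h0, h1, or_true, if_true, if_false, add_zero]
        rw [show ((i : ℝ) + 1 / 2) * Real.pi = i * Real.pi + Real.pi / 2 by ring,
          Real.cos_add_pi_div_two, Real.sin_nat_mul_pi, neg_zero]
      · right
        refine ⟨h1, ?_⟩
        simp only [h0, h1, or_self, if_false, add_zero]
        rw [Real.sin_nat_mul_pi]

/-- Excludes modes vanishing at every node. On the first interval the value at node 1 is `sin θ`
with `0 < θ < π`; elsewhere the value at node 0 is 1. -/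
lemma exists_cos_phase_ne_zero (hr : 1 ≤ r) {i : ℕ} (hi : i < localDim N r k) :
    ∃ m ≤ r, Real.cos (phase N r k i * m + phaseShift k) ≠ 0 := by
  by_cases h0 : k = 0
  · refine ⟨1, hr, ?_⟩
    have hr' : (0 : ℝ) < r := by positivity
    have hlt : phase N r k i < Real.pi := by
      rw [phase, div_lt_iff₀ hr', mul_comm Real.pi]
      refine mul_lt_mul_of_pos_right ?_ Real.pi_pos
      simp only [localDim, h0, true_or, if_true] at hi ⊢
      have : (i : ℝ) + 1 ≤ r := by exact_mod_cast hi
      linarith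
    have hpos : 0 < phase N r k i := by
      simp only [phase, h0, true_or, if_true]
      have := Real.pi_pos
      positivity
    rw [phaseShift, if_pos h0, Nat.cast_one, mul_one, ← sub_eq_add_neg, Real.cos_sub_pi_div_two]
    exact (Real.sin_pos_of_pos_of_lt_pi hpos hlt).ne'
  · exact ⟨0, r.zero_le, by simp [phaseShift, h0]⟩

lemma node_cases (hN : 1 ≤ N) (hr : 1 ≤ r) {m : ℕ} (hm : m ≤ r) :
    node N r k m ∉ Set.Ioo (0 : ℝ) 1 ∨ ∃ i < localDim N r k, m = freeIndex k i := by
  unfold localDim freeIndex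
  by_cases h0 : k = 0
  · simp only [h0, true_or, if_true]
    rcases Nat.eq_zero_or_pos m with rfl | hm0
    · left; simp [node]
    · exact Or.inr ⟨m - 1, by omega, by omega⟩
  · by_cases h1 : k + 1 = N
    · simp only [h0, h1, or_true, if_true, if_false]
      rcases hm.eq_or_lt with rfl | hm
      · left
        have : ((k : ℝ) + 1) / N = 1 := by
          have : (N : ℝ) ≠ 0 := by positivity
          rw [← h1] at this ⊢
          push_cast at *
          field_simp
        rw [node_last hr, this]; simp
      · exact Or.inr ⟨m, hm, rfl⟩
    · simp only [h0, h1, or_self, if_false]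
      exact Or.inr ⟨m, by omega, rfl⟩

end oneDim

/-! ### Completeness of the product modes and the full spectrum -/

section spectrum

variable {N r : ℕ} {k : Fin N × Fin N}

lemma IsMode.mul_mem_localSpace {θ α θ' α' : ℝ} {F G : ℝ → ℝ}
    (hF : IsMode N r k.1 θ α F) (hG : IsMode N r k.2 θ' α' G) :
    (cell N k).indicator (fun z => F z.1 * G z.2) ∈ localSpace N r k :=
  ⟨_, hF.mul_mem_femSpace hG, rfl⟩

lemma integrableOn_of_mem_localSpace {v w : ℝ × ℝ → ℝ} (hv : v ∈ localSpace N r k)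
    (hw : w ∈ localSpace N r k) : IntegrableOn (fun x => v x * w x) (cell N k) := by
  obtain ⟨u, hu, rfl⟩ := hv
  obtain ⟨u', hu', rfl⟩ := hw
  refine IntegrableOn.congr_fun ((hu.1.mul hu'.1).continuousOn.integrableOn_compact
    (isCompact_cell N k)) (fun z hz => ?_) (measurableSet_cell N k)
  rw [Set.indicator_of_mem hz, Set.indicator_of_mem hz, Pi.mul_apply]

/-- The mass form against a fixed function, as a linear functional. -/
noncomputable def massFunctional (w : localSpace N r k) : localSpace N r k →ₗ[ℝ] ℝ where
  toFun v := scaledMass N k v w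
  map_add' v v' := by
    simp only [scaledMass, Submodule.coe_add, Pi.add_apply, add_mul]
    rw [integral_add (integrableOn_of_mem_localSpace v.2 w.2)
      (integrableOn_of_mem_localSpace v'.2 w.2), mul_add]
  map_smul' c v := by
    simp only [scaledMass, Submodule.coe_smul, Pi.smul_apply, smul_eq_mul, mul_assoc,
      integral_const_mul, RingHom.id_apply]
    ring

lemma scaledMass_comm (v w : ℝ × ℝ → ℝ) : scaledMass N k v w = scaledMass N k w v := by
  simp only [scaledMass, mul_comm]

lemma stiffness_comm (v w : ℝ × ℝ → ℝ) : stiffness N k v w = stiffness N k w v := by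
  simp only [stiffness, mul_comm]

lemma scaledMass_mul (F G F' G' : ℝ → ℝ) :
    scaledMass N k (fun z => F z.1 * G z.2) (fun z => F' z.1 * G' z.2) =
      ((1 / (N : ℝ)) ^ 2)⁻¹ *
        ((∫ t in Set.Icc ((k.1 : ℝ) / N) (((k.1 : ℝ) + 1) / N), F t * F' t) *
          ∫ t in Set.Icc ((k.2 : ℝ) / N) (((k.2 : ℝ) + 1) / N), G t * G' t) := by
  rw [scaledMass, ← setIntegral_prod_mul, ← Measure.volume_eq_prod, cell_eq]
  simp only [mul_mul_mul_comm]

/-- Evaluation at the free nodes. -/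
noncomputable def nodalValues (N r : ℕ) (k : Fin N × Fin N) : localSpace N r k →ₗ[ℝ]
    (Fin (localDim N r k.1) × Fin (localDim N r k.2) → ℝ) where
  toFun v p := (v : ℝ × ℝ → ℝ) (node N r k.1 (freeIndex k.1 p.1), node N r k.2 (freeIndex k.2 p.2))
  map_add' _ _ := rfl
  map_smul' _ _ := rfl

lemma nodalValues_injective (hN : 1 ≤ N) (hr : 1 ≤ r) :
    Function.Injective (nodalValues N r k) := by
  rw [← LinearMap.ker_eq_bot, LinearMap.ker_eq_bot']
  rintro ⟨_, u, hu, rfl⟩ h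
  have key : ∀ x ∈ cell N k, u x = 0 := by
    refine eq_zero_of_node_eq_zero hu hN hr fun m hm l hl => ?_
    rcases node_cases (k := k.1) hN hr hm with h1 | ⟨i, hi, rfl⟩
    · exact hu.2.1 _ fun h => h1 h.1
    rcases node_cases (k := k.2) hN hr hl with h2 | ⟨j, hj, rfl⟩
    · exact hu.2.1 _ fun h => h2 h.2
    have h3 : (cell N k).indicator u
      (node N r k.1 (freeIndex k.1 i), node N r k.2 (freeIndex k.2 j)) = 0 :=
      congr_fun h (⟨i, hi⟩, ⟨j, hj⟩)
    rwa [Set.indicator_of_mem] at h3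
    exact ⟨node_mem hN hr hm, node_mem hN hr hl⟩
  ext x
  by_cases hx : x ∈ cell N k
  · simp [hx, key x hx]
  · simp [hx]

/-- The eigenvalues of the scaled discrete Laplace eigenproblem. -/
lemma isEigenvalue_iff (hN : 2 ≤ N) (hr : 1 ≤ r) {μ : ℝ} :
    IsEigenvalue N r k μ ↔ ∃ i < localDim N r k.1, ∃ j < localDim N r k.2,
      μ = (r : ℝ) ^ 2 * (symbol (phase N r k.1 i) + symbol (phase N r k.2 j)) := by
  have hN1 : 1 ≤ N := by omega
  choose F hF using exists_mode hN hr k.1.2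
  choose G hG using exists_mode hN hr k.2.2
  let ι := Fin (localDim N r k.1) × Fin (localDim N r k.2)
  let φ : ι → localSpace N r k := fun p => ⟨_, (hF p.1).mul_mem_localSpace (hG p.2)⟩
  let lam : ι → ℝ := fun p =>
    (r : ℝ) ^ 2 * (symbol (phase N r k.1 p.1) + symbol (phase N r k.2 p.2))
  have heig : ∀ p, ∀ w ∈ localSpace N r k,
      stiffness N k (φ p) w = lam p * scaledMass N k (φ p) w := by
    rintro p _ ⟨u, hu, rfl⟩
    simp only [φ]
    rw [stiffness_indicator, scaledMass_indicator, (hF p.1).stiffness_mul hu hN1 hr (hG p.2)]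
  have hmass : ∀ p q, scaledMass N k (φ p) (φ q) = ((1 / (N : ℝ)) ^ 2)⁻¹ *
        ((∫ t in Set.Icc ((k.1 : ℝ) / N) (((k.1 : ℝ) + 1) / N), F p.1 t * F q.1 t) *
          ∫ t in Set.Icc ((k.2 : ℝ) / N) (((k.2 : ℝ) + 1) / N), G p.2 t * G q.2 t) := by
    intro p q
    simp only [φ]
    rw [scaledMass_indicator, scaledMass_mul]
  have hpos : ∀ p, 0 < scaledMass N k (φ p) (φ p) := by
    intro p
    rw [hmass]
    obtain ⟨m, hm, hm'⟩ := exists_cos_phase_ne_zero hr p.1.2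
    obtain ⟨l, hl, hl'⟩ := exists_cos_phase_ne_zero hr p.2.2
    have h1 := (hF p.1).integral_mul_self_pos hN1 hr hm hm'
    have h2 := (hG p.2).integral_mul_self_pos hN1 hr hl hl'
    positivity
  have horth : ∀ p q, p ≠ q → scaledMass N k (φ p) (φ q) = 0 := by
    intro p q hpq
    rw [hmass]
    by_cases h : p.1 = q.1
    · have h' : (p.2 : ℕ) ≠ q.2 := fun h' => hpq (Prod.ext h (Fin.ext h'))
      rw [(hG p.2).integral_mul_eq_zero (hG q.2) hN1 hr k.2.2
        (symbol_phase_ne hr p.2.2 q.2.2 h'), mul_zero, mul_zero]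
    · have h' : (p.1 : ℕ) ≠ q.1 := fun h' => h (Fin.ext h')
      rw [(hF p.1).integral_mul_eq_zero (hF q.1) hN1 hr k.1.2
        (symbol_phase_ne hr p.1.2 q.1.2 h'), zero_mul, mul_zero]
  -- Pairing a vanishing combination with `φ q` leaves only the coefficient of `φ q`.
  have hli : LinearIndependent ℝ φ := by
    rw [Fintype.linearIndependent_iff]
    intro c hc q
    have h := congr_arg (massFunctional (φ q)) hc
    rw [map_sum, map_zero, Finset.sum_eq_single q] at h
    · rw [map_smul, smul_eq_mul] at h
      exact (mul_eq_zero.1 h).resolve_right (hpos q).ne'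
    · intro p _ hp
      rw [map_smul, smul_eq_mul]
      exact mul_eq_zero_of_right _ (horth p q hp)
    · exact fun h => absurd (Finset.mem_univ q) h
  have hinj := nodalValues_injective (k := k) hN1 hr
  have : FiniteDimensional ℝ (localSpace N r k) := FiniteDimensional.of_injective _ hinj
  -- Independence bounds the dimension below, injectivity of the nodal values bounds it above by the
  -- same number.
  have hcard : Fintype.card ι = Module.finrank ℝ (localSpace N r k) := by
    refine le_antisymm hli.fintype_card_le_finrank ?_
    have := LinearMap.finrank_le_finrank_of_injective hinj
    rwa [Module.finrank_fintype_fun_eq_card] at this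
  have hspan := hli.span_eq_top_of_card_eq_finrank' hcard
  constructor
  · rintro ⟨ψ, hψ, hw, h1⟩
    -- If `μ` differs from every `lam p`, symmetry makes `ψ` orthogonal to the basis, hence to
    -- itself, against the normalization.
    by_contra! hne
    have hz : ∀ p, massFunctional ⟨ψ, hψ⟩ (φ p) = 0 := by
      intro p
      change scaledMass N k (φ p) ψ = 0
      have e1 := hw _ (φ p).2
      rw [stiffness_comm, heig p ψ hψ, scaledMass_comm ψ, ← sub_eq_zero, ← sub_mul] at e1
      refine (mul_eq_zero.1 e1).resolve_left ?_
      exact sub_ne_zero.2 (hne p.1 p.1.2 p.2 p.2.2).symm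
    have hzero : massFunctional (⟨ψ, hψ⟩ : localSpace N r k) = 0 :=
      LinearMap.ext_on_range hspan fun p => by rw [hz p, LinearMap.zero_apply]
    have : scaledMass N k ψ ψ = 0 := LinearMap.congr_fun hzero ⟨ψ, hψ⟩
    rw [h1] at this
    exact one_ne_zero this
  · rintro ⟨i, hi, j, hj, rfl⟩
    let p : ι := (⟨i, hi⟩, ⟨j, hj⟩)
    let c : ℝ := (Real.sqrt (scaledMass N k (φ p) (φ p)))⁻¹
    have hs : ∀ w, stiffness N k (c • (φ p : ℝ × ℝ → ℝ)) w = c * stiffness N k (φ p) w := by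
      intro w
      have e1 : ∀ z, partial₁ (c • (φ p : ℝ × ℝ → ℝ)) z = c * partial₁ (φ p) z :=
        fun z => deriv_const_mul_field c
      have e2 : ∀ z, partial₂ (c • (φ p : ℝ × ℝ → ℝ)) z = c * partial₂ (φ p) z :=
        fun z => deriv_const_mul_field c
      simp only [stiffness, e1, e2, mul_assoc, ← mul_add, integral_const_mul]
    have hm : ∀ w, scaledMass N k (c • (φ p : ℝ × ℝ → ℝ)) w = c * scaledMass N k (φ p) w := by
      intro w
      simp only [scaledMass, Pi.smul_apply, smul_eq_mul, mul_assoc, integral_const_mul]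
      ring
    refine ⟨c • (φ p : ℝ × ℝ → ℝ), Submodule.smul_mem _ c (φ p).2, fun w hw => ?_, ?_⟩
    · rw [hs, hm, heig p w hw]
      simp only [lam, p]
      ring
    · rw [hm, scaledMass_comm, hm]
      have := hpos p
      simp only [c]
      have h2 := Real.mul_self_sqrt this.le
      have h3 := (Real.sqrt_pos.2 this).ne'
      field_simp
      nlinarith

end spectrum

/-! ### Which edges lie on the boundary -/

section boundary

variable {N : ℕ} {k : Fin N × Fin N}

lemma mem_frontier_unitSquare {x : ℝ × ℝ} : x ∈ frontier unitSquare ↔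
    (x.1 ∈ Set.Icc (0 : ℝ) 1 ∧ x.2 ∈ Set.Icc (0 : ℝ) 1) ∧
      ¬ (x.1 ∈ Set.Ioo (0 : ℝ) 1 ∧ x.2 ∈ Set.Ioo (0 : ℝ) 1) := by
  have ho : IsOpen unitSquare := isOpen_Ioo.prod isOpen_Ioo
  rw [ho.frontier_eq, unitSquare, closure_prod_eq, closure_Ioo zero_ne_one]
  rfl

lemma coarse_bounds (i : Fin N) : 0 ≤ (i : ℝ) / N ∧ (i : ℝ) / N < ((i : ℝ) + 1) / N ∧
    ((i : ℝ) + 1) / N ≤ 1 ∧ ((i : ℝ) / N = 0 ↔ (i : ℕ) = 0) ∧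
    (((i : ℝ) + 1) / N = 1 ↔ (i : ℕ) + 1 = N) := by
  have hN : (0 : ℝ) < N := by exact_mod_cast i.pos
  refine ⟨by positivity, by gcongr; linarith, ?_, ?_, ?_⟩
  · rw [div_le_one hN]; exact_mod_cast i.2
  · simp [hN.ne']
  · rw [div_eq_one_iff_eq hN.ne']; exact_mod_cast Iff.rfl

/-- The midpoint of an edge has one coordinate strictly between 0 and 1, so it is on the boundary
only if the other is 0 or 1. -/
lemma edge_subset_frontier_iff {a a' b b' : ℝ} (ha : 0 ≤ a) (haa : a < a') (ha' : a' ≤ 1) (hb : 0 ≤ b)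
    (hbb : b < b') (hb' : b' ≤ 1) :
    (({a} ×ˢ Set.Icc b b' ⊆ frontier unitSquare ↔ a = 0) ∧
    ({a'} ×ˢ Set.Icc b b' ⊆ frontier unitSquare ↔ a' = 1)) ∧
    (Set.Icc b b' ×ˢ {a} ⊆ frontier unitSquare ↔ a = 0) ∧
    (Set.Icc b b' ×ˢ {a'} ⊆ frontier unitSquare ↔ a' = 1) := by
  have hm : (b + b') / 2 ∈ Set.Icc b b' := ⟨by linarith, by linarith⟩
  refine ⟨⟨⟨fun h => ?_, fun h x hx => ?_⟩, ⟨fun h => ?_, fun h x hx => ?_⟩⟩,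
    ⟨⟨fun h => ?_, fun h x hx => ?_⟩, ⟨fun h => ?_, fun h x hx => ?_⟩⟩⟩
  · have := (mem_frontier_unitSquare.1 (h (Set.mk_mem_prod rfl hm))).2
    by_contra h0
    exact this ⟨⟨lt_of_le_of_ne ha (Ne.symm h0), by linarith⟩, by linarith, by linarith⟩
  · obtain ⟨h1, h2⟩ := hx
    rw [Set.mem_singleton_iff] at h1
    rw [mem_frontier_unitSquare, h1]
    exact ⟨⟨⟨ha, by linarith⟩, by linarith [h2.1], by linarith [h2.2]⟩, fun h3 => h3.1.1.ne' h⟩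
  · have := (mem_frontier_unitSquare.1 (h (Set.mk_mem_prod rfl hm))).2
    by_contra h0
    exact this ⟨⟨by linarith, lt_of_le_of_ne ha' h0⟩, by linarith, by linarith⟩
  · obtain ⟨h1, h2⟩ := hx
    rw [Set.mem_singleton_iff] at h1
    rw [mem_frontier_unitSquare, h1]
    exact ⟨⟨⟨by linarith, ha'⟩, by linarith [h2.1], by linarith [h2.2]⟩, fun h3 => h3.1.2.ne h⟩
  · have := (mem_frontier_unitSquare.1 (h (Set.mk_mem_prod hm rfl))).2
    by_contra h0
    exact this ⟨⟨by linarith, by linarith⟩, lt_of_le_of_ne ha (Ne.symm h0), by linarith⟩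
  · obtain ⟨h2, h1⟩ := hx
    rw [Set.mem_singleton_iff] at h1
    rw [mem_frontier_unitSquare, h1]
    exact ⟨⟨⟨by linarith [h2.1], by linarith [h2.2]⟩, ha, by linarith⟩, fun h3 => h3.2.1.ne' h⟩
  · have := (mem_frontier_unitSquare.1 (h (Set.mk_mem_prod hm rfl))).2
    by_contra h0
    exact this ⟨⟨by linarith, by linarith⟩, by linarith, lt_of_le_of_ne ha' h0⟩
  · obtain ⟨h2, h1⟩ := hx
    rw [Set.mem_singleton_iff] at h1
    rw [mem_frontier_unitSquare, h1]
    exact ⟨⟨⟨by linarith [h2.1], by linarith [h2.2]⟩, by linarith, ha'⟩, fun h3 => h3.2.2.ne h⟩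

lemma numBoundaryEdges_eq : numBoundaryEdges N k =
    ((if (k.1 : ℕ) = 0 then 1 else 0) + if (k.1 : ℕ) + 1 = N then 1 else 0) +
    ((if (k.2 : ℕ) = 0 then 1 else 0) + if (k.2 : ℕ) + 1 = N then 1 else 0) := by
  obtain ⟨a1, a2, a3, a4, a5⟩ := coarse_bounds k.1
  obtain ⟨b1, b2, b3, b4, b5⟩ := coarse_bounds k.2
  have h := (edge_subset_frontier_iff a1 a2 a3 b1 b2 b3).1
  have h' := (edge_subset_frontier_iff b1 b2 b3 a1 a2 a3).2
  rw [a4, a5] at h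
  rw [b4, b5] at h'
  classical
  rw [numBoundaryEdges, Set.ncard_eq_toFinset_card', Set.toFinset_ofPred, Finset.card_filter,
    Fin.sum_univ_four]
  simp [cellEdge, h, h', add_assoc]

lemma interior_of_disjoint (h : Disjoint (cell N k) (frontier unitSquare)) :
    ((k.1 : ℕ) ≠ 0 ∧ (k.1 : ℕ) + 1 ≠ N) ∧ (k.2 : ℕ) ≠ 0 ∧ (k.2 : ℕ) + 1 ≠ N := by
  obtain ⟨a1, a2, a3, a4, a5⟩ := coarse_bounds k.1
  obtain ⟨b1, b2, b3, b4, b5⟩ := coarse_bounds k.2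
  have e1 := (edge_subset_frontier_iff a1 a2 a3 b1 b2 b3).1
  have e2 := (edge_subset_frontier_iff b1 b2 b3 a1 a2 a3).2
  rw [a4, a5] at e1
  rw [b4, b5] at e2
  rw [Set.disjoint_left] at h
  have ia : (k.1 : ℝ) / N ∈ Set.Icc ((k.1 : ℝ) / N) (((k.1 : ℝ) + 1) / N) := ⟨le_rfl, a2.le⟩
  have ia' : ((k.1 : ℝ) + 1) / N ∈ Set.Icc ((k.1 : ℝ) / N) (((k.1 : ℝ) + 1) / N) := ⟨a2.le, le_rfl⟩
  have ib : (k.2 : ℝ) / N ∈ Set.Icc ((k.2 : ℝ) / N) (((k.2 : ℝ) + 1) / N) := ⟨le_rfl, b2.le⟩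
  have ib' : ((k.2 : ℝ) + 1) / N ∈ Set.Icc ((k.2 : ℝ) / N) (((k.2 : ℝ) + 1) / N) := ⟨b2.le, le_rfl⟩
  exact ⟨⟨fun h0 => h ⟨ia, ib⟩ (e1.1.2 h0 (Set.mk_mem_prod rfl ib)),
    fun h0 => h ⟨ia', ib⟩ (e1.2.2 h0 (Set.mk_mem_prod rfl ib))⟩,
    fun h0 => h ⟨ia, ib⟩ (e2.1.2 h0 (Set.mk_mem_prod ia rfl)),
    fun h0 => h ⟨ia, ib'⟩ (e2.2.2 h0 (Set.mk_mem_prod ia rfl))⟩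

end boundary

/-! ### The first nonzero eigenvalue and its bounds -/

/-- Used with `c = 1` and `c = 1/2`: the factor `r²` cancels the mesh dependence of the phase, and
`c ≤ r` keeps the phase in `(0, π]`. -/
lemma scaled_symbol_bounds {r : ℕ} {c : ℝ} (hr : 1 ≤ r) (hc : 0 < c) (hcr : c ≤ r) :
    (c * Real.pi) ^ 2 < (r : ℝ) ^ 2 * symbol (c * Real.pi / r) ∧
      (r : ℝ) ^ 2 * symbol (c * Real.pi / r) ≤ 3 * (c * Real.pi) ^ 2 := by
  have hr' : (0 : ℝ) < r := by positivity
  have hπ := Real.pi_pos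
  have e : (c * Real.pi) ^ 2 = (r : ℝ) ^ 2 * (c * Real.pi / r) ^ 2 := by field_simp
  rw [e]
  constructor
  · refine mul_lt_mul_of_pos_left (sq_lt_symbol (by positivity) ?_) (by positivity)
    rw [div_le_iff₀ hr']
    nlinarith
  · have := mul_le_mul_of_nonneg_left (symbol_le (c * Real.pi / r)) (sq_nonneg (r : ℝ))
    linarith

section firstEigenvalue

variable {N r : ℕ} {k : Fin N × Fin N}

lemma symbol_phase_le (hr : 1 ≤ r) {l i j : ℕ} (hij : i ≤ j) (hj : j < localDim N r l) :
    symbol (phase N r l i) ≤ symbol (phase N r l j) := by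
  rcases hij.eq_or_lt with rfl | h
  · exact le_rfl
  · exact (symbol_phase_lt hr h hj).le

lemma localDim_pos (hr : 1 ≤ r) (l : ℕ) : 0 < localDim N r l := by
  unfold localDim; split_ifs <;> omega

lemma isFirst_of_interior (hN : 2 ≤ N) (hr : 1 ≤ r) (h1 : (k.1 : ℕ) ≠ 0 ∧ (k.1 : ℕ) + 1 ≠ N)
    (h2 : (k.2 : ℕ) ≠ 0 ∧ (k.2 : ℕ) + 1 ≠ N) :
    IsFirstNonzeroEigenvalue N r k ((r : ℝ) ^ 2 * symbol (1 * Real.pi / r)) := by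
  have hd : ∀ l, l ≠ 0 ∧ l + 1 ≠ N → localDim N r l = r + 1 := fun l hl => by
    simp [localDim, hl]
  have hp0 : ∀ l, l ≠ 0 ∧ l + 1 ≠ N → symbol (phase N r l 0) = 0 := fun l hl => by
    simp [phase, hl, symbol_zero]
  have hp1 : ∀ l, l ≠ 0 ∧ l + 1 ≠ N → phase N r l 1 = 1 * Real.pi / r := fun l hl => by
    simp [phase, hl]
  have hb := (scaled_symbol_bounds (c := 1) hr one_pos (by exact_mod_cast hr)).1
  refine ⟨⟨((by positivity : (0 : ℝ) ≤ (1 * Real.pi) ^ 2).trans_lt hb).ne', ?_⟩, ?_⟩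
  · rw [isEigenvalue_iff hN hr]
    exact ⟨1, by rw [hd _ h1]; omega, 0, localDim_pos hr _, by rw [hp1 _ h1, hp0 _ h2, add_zero]⟩
  · rintro μ ⟨hμ, he⟩
    obtain ⟨i, hi, j, hj, rfl⟩ := (isEigenvalue_iff hN hr).1 he
    refine mul_le_mul_of_nonneg_left ?_ (sq_nonneg _)
    rcases Nat.eq_zero_or_pos i with rfl | hi0
    · rcases Nat.eq_zero_or_pos j with rfl | hj0
      -- The pair `(0, 0)` belongs to the constants, whose eigenvalue is zero; any other pair has an
      -- index at least 1.
      · exact absurd (by rw [hp0 _ h1, hp0 _ h2]; simp) hμ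
      · rw [← hp1 _ h2]
        linarith [symbol_phase_le hr hj0 hj, symbol_nonneg (phase N r k.1 0)]
    · rw [← hp1 _ h1]
      linarith [symbol_phase_le hr hi0 hi, symbol_nonneg (phase N r k.2 j)]

lemma isFirst_of_pos (hN : 2 ≤ N) (hr : 1 ≤ r)
    (h : 0 < (r : ℝ) ^ 2 * (symbol (phase N r k.1 0) + symbol (phase N r k.2 0))) :
    IsFirstNonzeroEigenvalue N r k
      ((r : ℝ) ^ 2 * (symbol (phase N r k.1 0) + symbol (phase N r k.2 0))) := by
  refine ⟨⟨h.ne', (isEigenvalue_iff hN hr).2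
    ⟨0, localDim_pos hr _, 0, localDim_pos hr _, rfl⟩⟩, ?_⟩
  rintro μ ⟨-, he⟩
  obtain ⟨i, hi, j, hj, rfl⟩ := (isEigenvalue_iff hN hr).1 he
  exact mul_le_mul_of_nonneg_left (add_le_add (symbol_phase_le hr i.zero_le hi)
    (symbol_phase_le hr j.zero_le hj)) (sq_nonneg _)

lemma phase_zero_of_boundary {l : ℕ} (h : l = 0 ∨ l + 1 = N) :
    phase N r l 0 = 1 / 2 * Real.pi / r := by
  simp [phase, h]

lemma phase_zero_of_interior {l : ℕ} (h : ¬ (l = 0 ∨ l + 1 = N)) : phase N r l 0 = 0 := by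
  simp [phase, h]

end firstEigenvalue

end ScaledQ1

open ScaledQ1 in
theorem mainTheorem9 :
    ∃ C : ℝ, ∀ (N r : ℕ), 1 ≤ N → 1 ≤ r → ∀ k : Fin N × Fin N,
      (Disjoint (ScaledQ1.cell N k) (frontier ScaledQ1.unitSquare) →
        ∃ μ : ℝ, ScaledQ1.IsFirstNonzeroEigenvalue N r k μ ∧ Real.pi ^ 2 < μ ∧ μ ≤ C) ∧
      (ScaledQ1.numBoundaryEdges N k = 1 →
        ∃ μ : ℝ, ScaledQ1.IsFirstNonzeroEigenvalue N r k μ ∧ Real.pi ^ 2 / 4 < μ ∧ μ ≤ C) ∧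
      (ScaledQ1.numBoundaryEdges N k = 2 →
        ∃ μ : ℝ, ScaledQ1.IsFirstNonzeroEigenvalue N r k μ ∧ Real.pi ^ 2 / 2 < μ ∧ μ ≤ C) := by
  -- The interior case dictates the constant; one and two boundary edges give `3 π² / 4` and `3 π² /
  -- 2`.
  refine ⟨3 * Real.pi ^ 2, fun N r _ hr k => ?_⟩
  have hr1 : (1 : ℝ) ≤ r := by exact_mod_cast hr
  have hπ := sq_nonneg Real.pi
  have hk1 := k.1.2
  have hk2 := k.2.2
  obtain ⟨hl, hu⟩ := scaled_symbol_bounds (c := 1 / 2) hr (by norm_num) (by linarith)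
  refine ⟨fun h => ?_, fun h => ?_, fun h => ?_⟩
  · obtain ⟨h1, h2⟩ := interior_of_disjoint h
    obtain ⟨hl, hu⟩ := scaled_symbol_bounds (c := 1) hr one_pos hr1
    rw [one_mul] at hl hu
    refine ⟨_, isFirst_of_interior (by omega) hr h1 h2, ?_, ?_⟩ <;> rwa [one_mul]
  · rw [numBoundaryEdges_eq] at h
    -- For `N = 1` all four edges lie on the boundary.
    have hN : 2 ≤ N := by
      by_contra hN
      split_ifs at h <;> omega
    have e : (r : ℝ) ^ 2 * (symbol (phase N r k.1 0) + symbol (phase N r k.2 0)) =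
        (r : ℝ) ^ 2 * symbol (1 / 2 * Real.pi / r) := by
      by_cases h1 : (k.1 : ℕ) = 0 ∨ (k.1 : ℕ) + 1 = N
      · have h2 : ¬ ((k.2 : ℕ) = 0 ∨ (k.2 : ℕ) + 1 = N) := by
          intro h2
          split_ifs at h <;> omega
        rw [phase_zero_of_boundary h1, phase_zero_of_interior h2, symbol_zero, add_zero]
      · have h2 : (k.2 : ℕ) = 0 ∨ (k.2 : ℕ) + 1 = N := by
          by_contra h2
          split_ifs at h <;> omega
        rw [phase_zero_of_interior h1, phase_zero_of_boundary h2, symbol_zero, zero_add]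
    refine ⟨_, isFirst_of_pos hN hr (by rw [e]; nlinarith), ?_, ?_⟩ <;> rw [e] <;> linarith
  · rw [numBoundaryEdges_eq] at h
    have hN : 2 ≤ N := by
      by_contra hN
      split_ifs at h <;> omega
    -- As `2 ≤ N`, opposite edges are not both on the boundary, so each direction contributes one
    -- edge.
    have h1 : (k.1 : ℕ) = 0 ∨ (k.1 : ℕ) + 1 = N := by
      by_contra h1
      split_ifs at h <;> omega
    have h2 : (k.2 : ℕ) = 0 ∨ (k.2 : ℕ) + 1 = N := by
      by_contra h2
      split_ifs at h <;> omega
    have e : (r : ℝ) ^ 2 * (symbol (phase N r k.1 0) + symbol (phase N r k.2 0)) =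
        2 * ((r : ℝ) ^ 2 * symbol (1 / 2 * Real.pi / r)) := by
      rw [phase_zero_of_boundary h1, phase_zero_of_boundary h2]
      ring
    refine ⟨_, isFirst_of_pos hN hr (by rw [e]; nlinarith), ?_, ?_⟩ <;> rw [e] <;> linarith
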